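/- Let $n\ge 0$ and let $s=(s_1,\dots,s_n)$ be a sequence of positive integers. Let \[ P_n^s=\left\{x\in\mathbb{R}^n : 0\le \frac{x_1}{s_1}\le\frac{x_2}{s_2}\le\cdots\le\frac{x_n}{s_n}\le 1\right\} \] be the $s$-lecture hall simplex, let $v^{(0)},\dots,v^{(n)}\in\mathbb{Z}^n$ be its vertices, and let \[ \Pi^\circ=\left\{\sum_{i=0}^n\lambda_i\,(v^{(i)},1)\in\mathbb{R}^{n+1} : 0<\lambda_i<1 \text{ for } i=0,\dots,n\right\} \] be its open parallelepiped. The $s$-derangement polynomial is the local $h^*$-polynomial (box polynomial) of $P_n^s$, \[ d_n^s(z)=\ell^*(P_n^s;z)=\sum_{(x_1,\dots,x_{n+1})\in\Pi^\circ\cap\mathbb{Z}^{n+1}}z^{x_{n+1}} . \] Then $d_n^s(z)$ is real-rooted, log-concave and unimodal. That is: either $d_n^s(z)=0$ or all complex zeros of $d_n^s(z)$ are real; and, writing $d_n^s(z)=p_0+p_1z+\cdots+p_dz^d$ with $d$ its degree ($d=0$ if the polynomial is zero), one has $p_k^2\ge p_{k-1}p_{k+1}$ for all $1\le k\le d-1$,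 and $p_0\le p_1\le\cdots\le p_t\ge p_{t+1}\ge\cdots\ge p_d$ for some $t\in\{0,\dots,d\}$. -/

import Mathlib

noncomputable section

namespace LectureHall

/-- The `s`-lecture hall simplex
`{x ∈ ℝⁿ : 0 ≤ x₁/s₁ ≤ x₂/s₂ ≤ ⋯ ≤ xₙ/sₙ ≤ 1}`. -/
def simplex {n : ℕ} (s : Fin n → ℕ) : Set (Fin n → ℝ) :=
  {x | (∀ i, 0 ≤ x i / (s i : ℝ)) ∧
       (∀ i j, i ≤ j → x i / (s i : ℝ) ≤ x j / (s j : ℝ)) ∧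
       (∀ i, x i / (s i : ℝ) ≤ 1)}

/-- The lift `(v, 1) ∈ ℝⁿ⁺¹` of a point `v ∈ ℝⁿ`. -/
def lift {n : ℕ} (v : Fin n → ℝ) : Fin (n + 1) → ℝ :=
  Fin.snoc (α := fun _ => ℝ) v 1

/-- The open parallelepiped of a simplex `P ⊆ ℝⁿ`: all sums `∑ λ_v (v, 1)` over the vertices `v`
of `P`, with `0 < λ_v < 1` for each vertex. The vertices of a polytope are its extreme points;
there are finitely many of them. -/
def openParallelepiped {n : ℕ} (P : Set (Fin n → ℝ)) : Set (Fin (n + 1) → ℝ) :=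
  {y | ∃ c : (Fin n → ℝ) → ℝ,
    (∀ v ∈ P.extremePoints ℝ, 0 < c v ∧ c v < 1) ∧
    y = ∑ᶠ v ∈ P.extremePoints ℝ, c v • lift v}

/-- The points of `ℤⁿ⁺¹` in the open parallelepiped of `P`. -/
def boxPoints {n : ℕ} (P : Set (Fin n → ℝ)) : Set (Fin (n + 1) → ℤ) :=
  {x | (fun i => (x i : ℝ)) ∈ openParallelepiped P}

/-- The local `h*`-polynomial (box polynomial) of a lattice simplex `P`: the sum of
`z ^ x_{n+1}` over all lattice points `x` of the open parallelepiped of `P`. This set is finite,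
and the height `x_{n+1}`, a sum of positive coefficients, is positive. -/
def localHStar {n : ℕ} (P : Set (Fin n → ℝ)) : Polynomial ℝ :=
  ∑ᶠ x ∈ boxPoints P, Polynomial.X ^ (x (Fin.last n)).toNat

/-- The `s`-derangement polynomial. -/
def derangementPolynomial {n : ℕ} (s : Fin n → ℕ) : Polynomial ℝ :=
  localHStar (simplex s)

/-- A real polynomial is real-rooted if it is zero or all its complex zeros are real. -/
def RealRooted (p : Polynomial ℝ) : Prop :=
  p = 0 ∨ ∀ z : ℂ, Polynomial.aeval z p = 0 → z.im = 0

/-- `p_{k-1} p_{k+1} ≤ p_k²` for all `1 ≤ k ≤ d - 1`, where `d` is the degree of `p`. -/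
def LogConcave (p : Polynomial ℝ) : Prop :=
  ∀ k, 1 ≤ k → k + 1 ≤ p.natDegree → p.coeff (k - 1) * p.coeff (k + 1) ≤ p.coeff k ^ 2

/-- `p₀ ≤ p₁ ≤ ⋯ ≤ p_t ≥ ⋯ ≥ p_d` for some `t`, where `d` is the degree of `p`. -/
def Unimodal (p : Polynomial ℝ) : Prop :=
  ∃ t ≤ p.natDegree, MonotoneOn p.coeff (Set.Iic t) ∧
    AntitoneOn p.coeff (Set.Icc t p.natDegree)

end LectureHall

end

/-! A lattice point of the open parallelepiped is a path 0 = x₀, x₁, …, xₙ₊₁ whose ratios xᵢ/sᵢ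
(with s₀ = sₙ₊₁ = 1) grow by steps strictly between 0 and 1; these steps are the coefficients λᵢ.
Subtracting xₙ₊₁ from all ratios gives paths that end at 0 and start at minus the height
(`bijOn_paths_boxPoints`). Hence for Im z < 0 and w = z⁻¹ the value of the polynomial at z is the
sum of w^(a₀) over paths ending at 0.

Fix the stage k and let the endpoint b vary. The path sums form a spiral: they turn
counterclockwise, by at most arg w < π per period, and a shift by the period sₖ multiplies them by
w. At stage 0 they are the powers of w. The next stage sums over a sliding window no longer than one
period, which preserves spirals (`IsSpiral.window_sum`). Such a window spans an angle less than π,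
so its sum vanishes only if every term does. A zero at z therefore propagates back to stage 0 and
shows that there are no paths: the polynomial is zero. Conjugation covers Im z > 0.

The coefficients are nonnegative, so all roots are nonpositive; building the polynomial from its
linear factors preserves log-concavity without internal zeros (`IsPF2.mul_X_sub_C`). -/

namespace LectureHall
open ComplexConjugate

/-! ### Spirals in the complex plane and their window sums -/

/-- The signed area spanned by two complex numbers. -/
def cross (u v : ℂ) : ℝ := (v * conj u).im

theorem cross_add_left (u u' v : ℂ) : cross (u + u') v = cross u v + cross u' v := by
  simp [cross, mul_add]

theorem cross_add_right (u v v' : ℂ) : cross u (v + v') = cross u v + cross u v' := by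
  simp [cross, add_mul]

theorem cross_self (u : ℂ) : cross u u = 0 := by
  simp [cross]; ring

theorem cross_mul_self (w u : ℂ) : cross u (w * u) = w.im * Complex.normSq u := by
  rw [cross, mul_assoc, Complex.mul_conj, Complex.im_mul_ofReal]

theorem cross_sum {ι κ : Type*} (s : Finset ι) (t : Finset κ) (f : ι → ℂ) (g : κ → ℂ) :
    cross (∑ i ∈ s, f i) (∑ j ∈ t, g j) = ∑ j ∈ t, ∑ i ∈ s, cross (f i) (g j) := by
  simp only [cross, map_sum, Finset.sum_mul_sum, Complex.im_sum]

theorem cross_sum_nonneg {ι κ : Type*} {s : Finset ι} {t : Finset κ} {f : ι → ℂ} {g : κ → ℂ}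
    (h : ∀ i ∈ s, ∀ j ∈ t, 0 ≤ cross (f i) (g j)) :
    0 ≤ cross (∑ i ∈ s, f i) (∑ j ∈ t, g j) := by
  rw [cross_sum]
  exact Finset.sum_nonneg fun j hj => Finset.sum_nonneg fun i hi => h i hi j hj

theorem sum_Ico_consecutive_int {M : Type*} [AddCommMonoid M] (G : ℤ → M) {a b c : ℤ}
    (hab : a ≤ b) (hbc : b ≤ c) :
    ∑ i ∈ Finset.Ico a c, G i = ∑ i ∈ Finset.Ico a b, G i + ∑ i ∈ Finset.Ico b c, G i := by
  rw [← Finset.Ico_union_Ico_eq_Ico hab hbc,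
    Finset.sum_union (Finset.Ico_disjoint_Ico_consecutive a b c)]

/-- A doubly infinite sequence of complex numbers that turns counterclockwise, at most by the
argument of `w` in every `m` steps, and is multiplied by `w` by a shift of `m` steps. -/
structure IsSpiral (m : ℤ) (w : ℂ) (G : ℤ → ℂ) : Prop where
  shift : ∀ i, G (i + m) = w * G i
  cross_nonneg : ∀ i j, i ≤ j → j ≤ i + m → 0 ≤ cross (G i) (G j)

namespace IsSpiral

variable {m : ℤ} {w : ℂ} {G : ℤ → ℂ}

theorem sum_Ico_shift (hG : IsSpiral m w G) (a b : ℤ) :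
    ∑ i ∈ Finset.Ico (a + m) (b + m), G i = w * ∑ i ∈ Finset.Ico a b, G i := by
  rw [← Finset.sum_Ico_add', Finset.mul_sum]
  simp only [hG.shift]

theorem cross_sum_Ico_nonneg (hG : IsSpiral m w G) {a b a' b' : ℤ}
    (h₁ : b ≤ a' + 1) (h₂ : b' ≤ a + m + 1) :
    0 ≤ cross (∑ i ∈ Finset.Ico a b, G i) (∑ i ∈ Finset.Ico a' b', G i) := by
  refine cross_sum_nonneg fun i hi j hj => hG.cross_nonneg i j ?_ ?_ <;>
    simp only [Finset.mem_Ico] at hi hj <;> omega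

theorem cross_sum_Ico_shift_nonneg (hG : IsSpiral m w G) (hw : 0 ≤ w.im) {p q p' q' : ℤ}
    (hp : p' ≤ p) (hq : q' ≤ q) (h : q ≤ p' + m) :
    0 ≤ cross (∑ i ∈ Finset.Ico p q, G i) (∑ i ∈ Finset.Ico (p' + m) (q' + m), G i) := by
  rcases le_total q' p with hqp | hpq
  · exact hG.cross_sum_Ico_nonneg (by omega) (by omega)
  -- Index pairs from the common part `[p, q')` and its shift can be more than `m` apart, so these
  -- are not compared termwise: the shifted sum is `w` times the original, and the cross product is
  -- `w.im` times a square.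
  · rw [sum_Ico_consecutive_int G hpq hq, cross_add_left,
      sum_Ico_consecutive_int G (add_le_add_left hp m) (add_le_add_left hpq m), cross_add_right,
      hG.sum_Ico_shift p q', cross_mul_self, ← hG.sum_Ico_shift p q',
      ← sum_Ico_consecutive_int G (add_le_add_left hp m) (add_le_add_left hpq m)]
    have h₁ := hG.cross_sum_Ico_nonneg (a := p) (b := q') (a' := p' + m) (b' := p + m)
      (by omega) (by omega)
    have h₂ := hG.cross_sum_Ico_nonneg (a := q') (b := q) (a' := p' + m) (b' := q' + m)
      (by omega) (by omega)
    have h₃ := mul_nonneg hw (Complex.normSq_nonneg (∑ i ∈ Finset.Ico p q', G i))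
    linarith

/-- The overlap of the two windows has zero cross product with itself. The other pairs are at most
`m` apart, except between the part left behind and the part gained, where the shift lemma applies.
-/
theorem cross_window_nonneg (hG : IsSpiral m w G) (hw : 0 ≤ w.im) {a b a' b' : ℤ}
    (ha : a ≤ a') (hb : b ≤ b') (hm : b ≤ a + m)
    (hm' : b' ≤ a' + m) (ha' : a' ≤ a + m) (hb' : b' ≤ b + m) :
    0 ≤ cross (∑ i ∈ Finset.Ico a b, G i) (∑ i ∈ Finset.Ico a' b', G i) := by
  rcases le_total a' b with h | h
  · rw [sum_Ico_consecutive_int G ha h, sum_Ico_consecutive_int G h hb]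
    simp only [cross_add_left, cross_add_right, cross_self]
    have h₁ := hG.cross_sum_Ico_nonneg (a := a) (b := a') (a' := a') (b' := b)
      (by omega) (by omega)
    have h₂ := hG.cross_sum_Ico_nonneg (a := a') (b := b) (a' := b) (b' := b')
      (by omega) (by omega)
    have h₃ := hG.cross_sum_Ico_shift_nonneg hw (p := a) (q := a') (p' := b - m) (q' := b' - m)
      (by omega) (by omega) (by omega)
    simp only [sub_add_cancel] at h₃
    linarith
  · have h₃ := hG.cross_sum_Ico_shift_nonneg hw (p := a) (q := b) (p' := a' - m) (q' := b' - m)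
      (by omega) (by omega) (by omega)
    simpa only [sub_add_cancel] using h₃

theorem window_sum (hG : IsSpiral m w G) (hw : 0 ≤ w.im) {m' : ℤ} {lo hi : ℤ → ℤ}
    (hlo : Monotone lo) (hhi : Monotone hi)
    (hlen : ∀ t, hi t ≤ lo t + m) (hlo' : ∀ t, lo (t + m') = lo t + m)
    (hhi' : ∀ t, hi (t + m') = hi t + m) :
    IsSpiral m' w fun t => ∑ i ∈ Finset.Ico (lo t) (hi t), G i where
  shift t := by rw [hlo', hhi', hG.sum_Ico_shift]
  cross_nonneg t u htu hut := hG.cross_window_nonneg hw (hlo htu) (hhi htu)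
    (hlen t) (hlen u) (hlo' t ▸ hlo hut) (hhi' t ▸ hhi hut)

/-- Leading zeros are peeled off by induction. If `G a ≠ 0`, a vanishing sum forces all terms onto
the line through `G a`. -/
theorem eq_zero_of_sum_Ico_eq_zero (hG : IsSpiral m w G) (hw : 0 < w.im) (N : ℕ) :
    ∀ {a b : ℤ}, b ≤ a + m → b = a + N → ∑ i ∈ Finset.Ico a b, G i = 0 →
      ∀ i ∈ Finset.Ico a b, G i = 0 := by
  induction N with
  | zero => intro a b _ hN _ i hi; simp [hN] at hi
  | succ N ih =>
    intro a b hab hN hsum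
    have hlt : a < b := by omega
    by_cases h0 : G a = 0
    · have hsplit := sum_Ico_consecutive_int G (a := a) (b := a + 1) (c := b) (by omega) (by omega)
      have hone : Finset.Ico a (a + 1) = {a} := by ext; simp; omega
      rw [hsum, hone, Finset.sum_singleton, h0, zero_add] at hsplit
      intro i hi
      rw [Finset.mem_Ico] at hi
      rcases eq_or_lt_of_le hi.1 with rfl | hi'
      · exact h0
      · exact ih (a := a + 1) (b := b) (by omega) (by push_cast at hN; omega) hsplit.symm i
          (Finset.mem_Ico.2 ⟨by omega, hi.2⟩)
    · exfalso
      have hpos : 0 < Complex.normSq (G a) := Complex.normSq_pos.2 h0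
      have hre (j) (hj : j ∈ Finset.Ico a b) : 0 ≤ cross (G a) (G j) := by
        rw [Finset.mem_Ico] at hj
        exact hG.cross_nonneg a j hj.1 (by omega)
      have hzero : ∑ j ∈ Finset.Ico a b, cross (G a) (G j) = 0 := by
        have := cross_sum {a} (Finset.Ico a b) G G
        simpa [hsum, cross] using this.symm
      have him := (Finset.sum_eq_zero_iff_of_nonneg hre).1 hzero
      -- Comparison with `G (a + m) = w * G a` puts each collinear term on the same ray as `G a`, so
      -- they cannot cancel.
      have hcoef (j) (hj : j ∈ Finset.Ico a b) : 0 ≤ (G j * conj (G a)).re := by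
        have h₁ := him j hj
        rw [Finset.mem_Ico] at hj
        have h₂ := hG.cross_nonneg j (a + m) (by omega) (by omega)
        rw [hG.shift] at h₂
        simp only [cross, Complex.mul_im, Complex.mul_re, Complex.conj_re, Complex.conj_im]
          at h₁ h₂ ⊢
        refine nonneg_of_mul_nonneg_right (a := w.im) ?_ hw
        linear_combination h₂ - w.re * h₁
      have htot : ∑ j ∈ Finset.Ico a b, (G j * conj (G a)).re = 0 := by
        rw [← Complex.re_sum, ← Finset.sum_mul, hsum]; simp
      have := (Finset.sum_eq_zero_iff_of_nonneg hcoef).1 htot a (Finset.mem_Ico.2 ⟨le_rfl, hlt⟩)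
      rw [Complex.mul_conj, Complex.ofReal_re] at this
      exact hpos.ne' this

theorem eq_zero_of_window_sum_eq_zero (hG : IsSpiral m w G) (hw : 0 < w.im) {a b : ℤ}
    (hab : b ≤ a + m) (hsum : ∑ i ∈ Finset.Ico a b, G i = 0) {i : ℤ}
    (hi : i ∈ Finset.Ico a b) : G i = 0 := by
  have hi' := Finset.mem_Ico.1 hi
  exact hG.eq_zero_of_sum_Ico_eq_zero hw (b - a).toNat hab (by omega) hsum i hi

end IsSpiral

theorem isSpiral_zpow {w : ℂ} (hw : 0 < w.im) : IsSpiral 1 w fun a => w ^ a := by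
  have hw0 : w ≠ 0 := by rintro rfl; simp at hw
  have hshift (i : ℤ) : w ^ (i + 1) = w * w ^ i := by rw [zpow_add_one₀ hw0, mul_comm]
  refine ⟨hshift, fun i j hij hji => ?_⟩
  obtain rfl | rfl : j = i ∨ j = i + 1 := by omega
  · rw [cross_self]
  · rw [hshift, cross_mul_self]
    exact mul_nonneg hw.le (Complex.normSq_nonneg _)

/-! ### Log-concavity and unimodality from real roots -/

open Polynomial

/-- A polynomial with nonnegative coefficients that are log-concave without internal zeros. -/
structure IsPF2 (p : ℝ[X]) : Prop where
  nonneg : ∀ i, 0 ≤ p.coeff i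
  mul_le : ∀ i j, i ≤ j → p.coeff i * p.coeff (j + 2) ≤ p.coeff (i + 1) * p.coeff (j + 1)

namespace IsPF2

theorem C_of_nonneg {a : ℝ} (ha : 0 ≤ a) : IsPF2 (C a) where
  nonneg i := by rw [coeff_C]; split_ifs <;> simp [ha]
  mul_le i j _ := by simp [coeff_C]

theorem mul_X_sub_C {p : ℝ[X]} (hp : IsPF2 p) {r : ℝ} (hr : r ≤ 0) :
    IsPF2 (p * (X - C r)) := by
  obtain ⟨t, rfl⟩ : ∃ t, r = -t := ⟨-r, by simp⟩
  have ht : 0 ≤ t := by linarith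
  have h0 : (p * (X - C (-t))).coeff 0 = t * p.coeff 0 := by
    simp [mul_coeff_zero, mul_comm]
  have hs (k : ℕ) : (p * (X - C (-t))).coeff (k + 1) = p.coeff k + t * p.coeff (k + 1) := by
    rw [coeff_mul_X_sub_C]; ring
  have hn := hp.nonneg
  refine ⟨fun i => ?_, fun i j hij => ?_⟩
  · cases i with
    | zero => rw [h0]; exact mul_nonneg ht (hn 0)
    | succ i => rw [hs]; exact add_nonneg (hn i) (mul_nonneg ht (hn _))
  · cases i with
    | zero =>
      cases j with
      | zero =>
        simp only [h0, hs]
        have h₁ := mul_le_mul_of_nonneg_left (hp.mul_le 0 0 le_rfl) (mul_nonneg ht ht)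
        have h₂ := mul_nonneg (hn 0) (hn 0)
        have h₃ := mul_nonneg ht (mul_nonneg (hn 0) (hn 1))
        norm_num at h₁ ⊢
        nlinarith
      | succ j =>
        simp only [h0, hs]
        have h₁ := mul_le_mul_of_nonneg_left (hp.mul_le 0 (j + 1) (by omega)) (mul_nonneg ht ht)
        have h₂ := mul_nonneg (hn 0) (hn (j + 1))
        have h₃ := mul_nonneg ht (mul_nonneg (hn 1) (hn (j + 1)))
        norm_num at h₁ ⊢
        nlinarith
    | succ i =>
      obtain ⟨j, rfl⟩ : ∃ k, j = k + 1 := ⟨j - 1, by omega⟩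
      have hij' : i ≤ j := by omega
      rw [hs, show j + 1 + 2 = (j + 2) + 1 from rfl, hs, hs, hs]
      have h₁ := hp.mul_le i j hij'
      have h₂ := mul_le_mul_of_nonneg_left (hp.mul_le (i + 1) (j + 1) hij) (mul_nonneg ht ht)
      -- This bounds the mixed terms, those linear in `t`; it needs two log-concavity steps unless
      -- `i = j`.
      have h₃ : p.coeff i * p.coeff (j + 3) ≤ p.coeff (i + 2) * p.coeff (j + 1) := by
        have h₄ := hp.mul_le i (j + 1) (by omega)
        rcases eq_or_lt_of_le hij' with rfl | hlt
        · linarith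
        · exact h₄.trans (hp.mul_le (i + 1) j hlt)
      have h₅ := mul_le_mul_of_nonneg_left h₃ ht
      nlinarith

theorem C_mul_prod {a : ℝ} (ha : 0 ≤ a) (s : Multiset ℝ) (hs : ∀ r ∈ s, r ≤ 0) :
    IsPF2 (C a * (s.map fun r => X - C r).prod) := by
  induction s using Multiset.induction_on with
  | empty => simpa using C_of_nonneg ha
  | cons r s ih =>
    rw [Multiset.map_cons, Multiset.prod_cons, mul_comm (X - C r), ← mul_assoc]
    exact (ih fun x hx => hs x (Multiset.mem_cons_of_mem hx)).mul_X_sub_C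
      (hs r (Multiset.mem_cons_self r s))

theorem logConcave {p : ℝ[X]} (hp : IsPF2 p) : LogConcave p := by
  rintro (_ | k) hk _
  · omega
  · rw [sq]
    exact hp.mul_le k k le_rfl

theorem coeff_mul_le {p : ℝ[X]} (hp : IsPF2 p) {i j : ℕ} (hij : i < j) :
    p.coeff i * p.coeff (j + 1) ≤ p.coeff (i + 1) * p.coeff j := by
  obtain ⟨j, rfl⟩ : ∃ k, j = k + 1 := ⟨j - 1, by omega⟩
  exact hp.mul_le i j (by omega)

/-- Log-concavity compares a consecutive pair with the pair next to a maximal coefficient, which is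
cancelled when positive. -/
theorem unimodal {p : ℝ[X]} (hp : IsPF2 p) : Unimodal p := by
  obtain ⟨t, ht, hmax⟩ := Finset.exists_max_image (Finset.range (p.natDegree + 1)) p.coeff
    ⟨0, by simp⟩
  have htop (i : ℕ) : p.coeff i ≤ p.coeff t := by
    by_cases hi : i ≤ p.natDegree
    · exact hmax i (Finset.mem_range.2 (by omega))
    · rw [coeff_eq_zero_of_natDegree_lt (by omega)]
      exact hp.nonneg t
  rw [Finset.mem_range] at ht
  have hup (i : ℕ) (hi : i < t) : p.coeff i ≤ p.coeff (i + 1) := by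
    rcases (hp.nonneg t).eq_or_lt with h0 | hpos
    · exact ((htop i).trans h0.symm.le).trans (hp.nonneg _)
    · obtain ⟨t, rfl⟩ : ∃ k, t = k + 1 := ⟨t - 1, by omega⟩
      rcases eq_or_lt_of_le (Nat.lt_succ_iff.1 hi) with rfl | hlt
      · exact htop i
      · exact le_of_mul_le_mul_right ((hp.coeff_mul_le hlt).trans
          (mul_le_mul_of_nonneg_left (htop t) (hp.nonneg _))) hpos
  have hdown (i : ℕ) (hi : t ≤ i) : p.coeff (i + 1) ≤ p.coeff i := by
    rcases (hp.nonneg t).eq_or_lt with h0 | hpos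
    · exact ((htop _).trans h0.symm.le).trans (hp.nonneg _)
    · rcases eq_or_lt_of_le hi with rfl | hlt
      · exact htop _
      · exact le_of_mul_le_mul_left ((hp.coeff_mul_le hlt).trans
          (mul_le_mul_of_nonneg_right (htop _) (hp.nonneg _))) hpos
  refine ⟨t, by omega, ?_, ?_⟩
  · refine monotoneOn_of_le_succ Set.ordConnected_Iic fun i _ _ hi => hup i ?_
    exact Nat.lt_of_succ_le hi
  · exact antitoneOn_of_succ_le Set.ordConnected_Icc fun i _ hi _ => hdown i hi.1

end IsPF2

theorem isPF2_of_realRooted {p : ℝ[X]} (hp : ∀ i, 0 ≤ p.coeff i) (hr : RealRooted p) :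
    IsPF2 p := by
  rcases eq_or_ne p 0 with rfl | h0
  · simpa using IsPF2.C_of_nonneg le_rfl
  replace hr := hr.resolve_left h0
  have hsplit : p.Splits := by
    refine Splits.of_splits_map (algebraMap ℝ ℂ) (IsAlgClosed.splits _) fun z hz => ?_
    have him := hr z (by simpa [h0] using hz)
    exact ⟨z.re, Complex.ext (by simp) (by simp [him])⟩
  rw [hsplit.eq_prod_roots]
  refine IsPF2.C_mul_prod (hp _) _ fun r hroot => ?_
  -- At a positive root all the nonnegative terms vanish, including the leading one.
  by_contra! hpos
  have hsum := (mem_roots'.1 hroot).2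
  rw [IsRoot, eval_eq_sum_range] at hsum
  have := (Finset.sum_eq_zero_iff_of_nonneg fun i _ =>
    mul_nonneg (hp i) (pow_nonneg hpos.le i)).1 hsum p.natDegree (by simp)
  simp [h0, hpos.ne'] at this

open ComplexConjugate Polynomial

/-! ### Lattice paths and their generating sums -/

section Paths

/-- The integers `a` with `0 < b / q - a / p < 1`. -/
noncomputable def window (p q : ℕ) (b : ℤ) : Finset ℤ :=
  Finset.Ico (p * b / q - p + 1) (-(-(p * b) / q))

theorem mem_window {p q : ℕ} (hq : 0 < q) {a b : ℤ} :
    a ∈ window p q b ↔ a * q < b * p ∧ b * p < (a + p) * q := by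
  have hq' : (0 : ℤ) < q := by exact_mod_cast hq
  have h₁ : (p * b / q - p + 1 ≤ a) ↔ p * b < (a + p) * q := by
    rw [← Int.ediv_lt_iff_lt_mul hq']; omega
  have h₂ : (a < -(-(p * b) / q)) ↔ -(p * b) < -a * (q : ℤ) := by
    rw [← Int.ediv_lt_iff_lt_mul hq']; omega
  rw [window, Finset.mem_Ico, h₁, h₂, and_comm, mul_comm (p : ℤ) b]
  refine and_congr_left fun _ => ?_
  constructor <;> intro h <;> linarith

/-- The endpoints are governed by the floor and ceiling of `p * b / q`: they are monotone in `b`,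
move by `p` when `b` moves by `q`, and enclose at most `p` integers. -/
theorem IsSpiral.sum_window {p q : ℕ} (hq : 0 < q) {w : ℂ} (hw : 0 < w.im) {G : ℤ → ℂ}
    (hG : IsSpiral p w G) : IsSpiral q w fun b => ∑ a ∈ window p q b, G a := by
  have hq' : (0 : ℤ) < q := by exact_mod_cast hq
  have hdiv (b : ℤ) : p * (b + q) / q = p * b / q + p := by
    rw [mul_add, Int.add_mul_ediv_right _ _ hq'.ne']
  have hdiv' (b : ℤ) : -(p * (b + q)) / q = -(p * b) / q - p := by
    rw [show -((p : ℤ) * (b + q)) = -(p * b) + (-p) * q by ring,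
      Int.add_mul_ediv_right _ _ hq'.ne']
    ring
  refine hG.window_sum hw.le ?_ ?_ ?_ ?_ ?_
  · intro b c hbc
    have := Int.ediv_le_ediv hq' (mul_le_mul_of_nonneg_left hbc (Int.natCast_nonneg p))
    beta_reduce; omega
  · intro b c hbc
    have := Int.ediv_le_ediv hq'
      (neg_le_neg (mul_le_mul_of_nonneg_left hbc (Int.natCast_nonneg p)))
    beta_reduce; omega
  · intro b
    have h₁ : p * b / q * (q : ℤ) ≤ p * b := Int.ediv_mul_le _ hq'.ne'
    have h₂ : p * b < (p * b / q + 1) * (q : ℤ) := Int.lt_ediv_add_one_mul_self _ hq'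
    have h₃ : -(p * b) < (-(p * b) / q + 1) * (q : ℤ) := Int.lt_ediv_add_one_mul_self _ hq'
    have h₄ : (0 : ℤ) < ((p * b / q + 1) + (-(p * b) / q + 1)) * q := by
      rw [add_mul]; linarith
    have := pos_of_mul_pos_left h₄ hq'.le
    omega
  · intro b; rw [hdiv]; ring
  · intro b; rw [hdiv']; ring

theorem IsSpiral.eq_zero_of_sum_window_eq_zero {p q : ℕ} (hq : 0 < q) {w : ℂ} (hw : 0 < w.im)
    {G : ℤ → ℂ} (hG : IsSpiral p w G) {a b : ℤ} (hsum : ∑ a ∈ window p q b, G a = 0)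
    (ha : a ∈ window p q b) : G a = 0 := by
  have hq' : (0 : ℤ) < q := by exact_mod_cast hq
  refine hG.eq_zero_of_window_sum_eq_zero hw ?_ hsum ha
  have h₁ : p * b / q * (q : ℤ) ≤ p * b := Int.ediv_mul_le _ hq'.ne'
  have h₂ : p * b < (p * b / q + 1) * (q : ℤ) := Int.lt_ediv_add_one_mul_self _ hq'
  have h₃ : -(p * b) < (-(p * b) / q + 1) * (q : ℤ) := Int.lt_ediv_add_one_mul_self _ hq'
  have h₄ : (0 : ℤ) < ((p * b / q + 1) + (-(p * b) / q + 1)) * q := by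
    rw [add_mul]; linarith
  have := pos_of_mul_pos_left h₄ hq'.le
  omega

open Classical in
/-- The sequences `a₀, …, aₖ = b` with `0 < aᵢ₊₁ / Sᵢ₊₁ - aᵢ / Sᵢ < 1` for `i < k`, continued
constantly. -/
noncomputable def paths (S : ℕ → ℕ) : ℕ → ℤ → Finset (ℕ → ℤ)
  | 0, b => {fun _ => b}
  | k + 1, b => (window (S k) (S (k + 1)) b).biUnion fun a =>
      (paths S k a).image fun f i => if i ≤ k then f i else b

variable {S : ℕ → ℕ}

theorem mem_paths (hS : ∀ i, 0 < S i) {k : ℕ} {b : ℤ} {f : ℕ → ℤ} :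
    f ∈ paths S k b ↔ (∀ i, k ≤ i → f i = b) ∧ ∀ i < k,
      f i * S (i + 1) < f (i + 1) * S i ∧ f (i + 1) * S i < (f i + S i) * S (i + 1) := by
  induction k generalizing b f with
  | zero =>
    simp [paths, funext_iff]
  | succ k ih =>
    simp only [paths, Finset.mem_biUnion, Finset.mem_image, ih, mem_window (hS _)]
    constructor
    · rintro ⟨a, ha, g, ⟨hg, hg'⟩, rfl⟩
      refine ⟨fun i hi => if_neg (by omega), fun i hi => ?_⟩
      rcases eq_or_lt_of_le (Nat.lt_succ_iff.1 hi) with rfl | hlt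
      · simpa [hg i le_rfl] using ha
      · simpa [hlt.le, Nat.succ_le_of_lt hlt] using hg' i hlt
    · rintro ⟨hf, hf'⟩
      refine ⟨f k, by simpa [hf (k + 1) le_rfl] using hf' k (Nat.lt_succ_self k),
        fun i => if i ≤ k then f i else f k, ⟨fun i hi => ?_, fun i hi => ?_⟩, ?_⟩
      · rcases eq_or_lt_of_le hi with rfl | hlt
        · simp
        · exact if_neg (by omega)
      · simpa [hi.le, Nat.succ_le_of_lt hi] using hf' i (by omega)
      · funext i
        by_cases hi : i ≤ k
        · simp [hi]
        · simp [hi, hf i (by omega)]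

theorem sum_paths_succ (hS : ∀ i, 0 < S i) {M : Type*} [AddCommMonoid M] (g : ℤ → M) (k : ℕ)
    (b : ℤ) : ∑ f ∈ paths S (k + 1) b, g (f 0) =
      ∑ a ∈ window (S k) (S (k + 1)) b, ∑ f ∈ paths S k a, g (f 0) := by
  classical
  rw [paths, Finset.sum_biUnion]
  · refine Finset.sum_congr rfl fun a _ => ?_
    rw [Finset.sum_image]
    · simp
    · intro f hf f' hf' h
      rw [Finset.mem_coe, mem_paths hS] at hf hf'
      funext i
      by_cases hi : i ≤ k
      · simpa [hi] using congrFun h i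
      · rw [hf.1 i (by omega), hf'.1 i (by omega)]
  · intro a _ a' _ haa'
    refine Finset.disjoint_left.2 fun f hf hf' => haa' ?_
    obtain ⟨g, hg, rfl⟩ := Finset.mem_image.1 hf
    obtain ⟨g', hg', h⟩ := Finset.mem_image.1 hf'
    have := congrFun h k
    rw [mem_paths hS] at hg hg'
    simpa [hg.1 k le_rfl, hg'.1 k le_rfl] using this.symm

theorem isSpiral_sum_paths (hS : ∀ i, 0 < S i) (h0 : S 0 = 1) {w : ℂ} (hw : 0 < w.im) (k : ℕ) :
    IsSpiral (S k) w fun b => ∑ f ∈ paths S k b, w ^ f 0 := by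
  induction k with
  | zero => simpa [paths, h0] using isSpiral_zpow hw
  | succ k ih =>
    simp only [sum_paths_succ hS fun a => w ^ a]
    exact ih.sum_window (hS _) hw

theorem paths_eq_empty_of_sum_eq_zero (hS : ∀ i, 0 < S i) (h0 : S 0 = 1) {w : ℂ}
    (hw : 0 < w.im) {k : ℕ} {b : ℤ} (hsum : ∑ f ∈ paths S k b, w ^ f 0 = 0) :
    paths S k b = ∅ := by
  induction k generalizing b with
  | zero =>
    have hw0 : w ≠ 0 := by rintro rfl; simp at hw
    simp [paths, zpow_ne_zero b hw0] at hsum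
  | succ k ih =>
    classical
    rw [sum_paths_succ hS fun a => w ^ a] at hsum
    rw [paths, Finset.eq_empty_iff_forall_notMem]
    intro f hf
    obtain ⟨a, ha, hf⟩ := Finset.mem_biUnion.1 hf
    rw [ih ((isSpiral_sum_paths hS h0 hw k).eq_zero_of_sum_window_eq_zero (hS _) hw hsum ha),
      Finset.image_empty] at hf
    exact Finset.notMem_empty f hf

/-- The ratios increase along a path, so going back from 0 keeps them nonpositive. This makes the
truncation in `(-f 0).toNat` harmless. -/
theorem nonpos_of_mem_paths (hS : ∀ i, 0 < S i) {k : ℕ} {f : ℕ → ℤ} (hf : f ∈ paths S k 0) :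
    f 0 ≤ 0 := by
  rw [mem_paths hS] at hf
  suffices ∀ j ≤ k, f (k - j) ≤ 0 by simpa using this k le_rfl
  intro j
  induction j with
  | zero => intro _; exact (hf.1 k le_rfl).le
  | succ j ih =>
    intro hj
    have h₁ := (hf.2 (k - (j + 1)) (by omega)).1
    rw [show k - (j + 1) + 1 = k - j by omega] at h₁
    have h₂ : f (k - j) * (S (k - (j + 1)) : ℤ) ≤ 0 :=
      mul_nonpos_of_nonpos_of_nonneg (ih (by omega)) (Int.natCast_nonneg _)
    have h₃ : (0 : ℤ) < S (k - j) := by exact_mod_cast hS _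
    by_contra! h₄
    have := mul_pos h₄ h₃
    omega

end Paths

/-! ### Vertices and box points of the lecture hall simplex -/

section Geometry

variable {n : ℕ} {s : Fin n → ℕ}

/-- The sequence `1, s₁, …, sₙ, 1, 1, …`. -/
def denominators (s : Fin n → ℕ) : ℕ → ℕ
  | 0 => 1
  | i + 1 => if h : i < n then s ⟨i, h⟩ else 1

/-- The sequence `0, x₁, …, xₙ₊₁, 0, 0, …`. -/
def coordinates (x : Fin (n + 1) → ℤ) : ℕ → ℤ
  | 0 => 0
  | i + 1 => if h : i < n + 1 then x ⟨i, h⟩ else 0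

theorem denominators_pos (hs : ∀ i, 0 < s i) : ∀ i, 0 < denominators s i
  | 0 => Nat.one_pos
  | i + 1 => by
    rw [denominators]
    split_ifs with h
    · exact hs _
    · exact Nat.one_pos

theorem denominators_last : denominators s (n + 1) = 1 := by simp [denominators]

/-- The vertex `(0, …, 0, sⱼ₊₁, …, sₙ)` of the lecture hall simplex. -/
def vertex (s : Fin n → ℕ) (j : Fin (n + 1)) : Fin n → ℝ :=
  fun i => if (j : ℕ) ≤ i then s i else 0

theorem lift_vertex (j i : Fin (n + 1)) :
    lift (vertex s j) i = if (j : ℕ) ≤ i then (denominators s (i + 1) : ℝ) else 0 := by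
  refine Fin.lastCases ?_ (fun i => ?_) i
  · simp [lift, denominators_last, Nat.lt_succ_iff.1 j.isLt]
  · simp [lift, vertex, denominators]

theorem vertex_injective (hs : ∀ i, 0 < s i) : Function.Injective (vertex s) := by
  have key (j k : Fin (n + 1)) (hjk : j < k) : vertex s j ≠ vertex s k := by
    intro h
    have hj : (j : ℕ) < n := by omega
    have := congrFun h ⟨j, hj⟩
    have hlt : ¬ (k : ℕ) ≤ j := by omega
    simp [vertex, hlt, (hs ⟨j, hj⟩).ne'] at this
  intro j k h
  by_contra hne
  rcases lt_or_gt_of_ne hne with hlt | hlt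
  · exact key j k hlt h
  · exact key k j hlt h.symm

theorem sum_ite_le_of_eq_sub {c : Fin (n + 1) → ℝ} {y : ℕ → ℝ} (h0 : y 0 = 0)
    (hc : ∀ i : Fin (n + 1), c i = y (i + 1) - y i) (i : ℕ) (hi : i ≤ n) :
    ∑ j : Fin (n + 1), (if (j : ℕ) ≤ i then c j else 0) = y (i + 1) := by
  simp only [hc]
  rw [Fin.sum_univ_eq_sum_range (fun j => if j ≤ i then y (j + 1) - y j else 0),
    ← Finset.sum_filter]
  have : (Finset.range (n + 1)).filter (· ≤ i) = Finset.range (i + 1) := by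
    ext; simp; omega
  rw [this, Finset.sum_range_sub, h0, sub_zero]

theorem eq_sub_of_sum_ite_le {c : Fin (n + 1) → ℝ} {y : ℕ → ℝ} (h0 : y 0 = 0)
    (hy : ∀ i ≤ n, ∑ j : Fin (n + 1), (if (j : ℕ) ≤ i then c j else 0) = y (i + 1))
    (i : Fin (n + 1)) : c i = y (i + 1) - y i := by
  let Y (k : ℕ) : ℝ := ∑ j ∈ Finset.range k, if h : j < n + 1 then c ⟨j, h⟩ else 0
  have hY (i : Fin (n + 1)) : c i = Y (i + 1) - Y i := by
    simp [Y, Finset.sum_range_succ, i.isLt, -Order.lt_add_one_iff]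
  have hyY : ∀ k ≤ n + 1, y k = Y k
    | 0, _ => by simp [Y, h0]
    | k + 1, hk => by
      rw [← hy k (by omega), sum_ite_le_of_eq_sub (y := Y) (by simp [Y]) hY k (by omega)]
  rw [hyY _ (by omega), hyY _ (by omega), hY]

theorem vertex_mem_simplex (hs : ∀ i, 0 < s i) (j : Fin (n + 1)) : vertex s j ∈ simplex s := by
  have hdiv (i : Fin n) : vertex s j i / s i = if (j : ℕ) ≤ i then 1 else 0 := by
    have : (s i : ℝ) ≠ 0 := by exact_mod_cast (hs i).ne'
    rw [vertex]; split_ifs <;> simp [this]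
  refine ⟨fun i => ?_, fun i k hik => ?_, fun i => ?_⟩
  · rw [hdiv]; split_ifs <;> simp
  · rw [hdiv, hdiv]
    have : (i : ℕ) ≤ k := hik
    split_ifs <;> first | omega | norm_num
  · rw [hdiv]; split_ifs <;> simp

theorem convex_simplex (s : Fin n → ℕ) : Convex ℝ (simplex s) := by
  rintro x ⟨hx₁, hx₂, hx₃⟩ y ⟨hy₁, hy₂, hy₃⟩ a b ha hb hab
  have hdiv (i : Fin n) : (a • x + b • y) i / s i = a * (x i / s i) + b * (y i / s i) := by
    simp only [Pi.add_apply, Pi.smul_apply, smul_eq_mul]; ring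
  refine ⟨fun i => ?_, fun i j hij => ?_, fun i => ?_⟩
  · rw [hdiv]
    exact add_nonneg (mul_nonneg ha (hx₁ i)) (mul_nonneg hb (hy₁ i))
  · rw [hdiv, hdiv]
    exact add_le_add (mul_le_mul_of_nonneg_left (hx₂ i j hij) ha)
      (mul_le_mul_of_nonneg_left (hy₂ i j hij) hb)
  · rw [hdiv, ← hab]
    exact add_le_add (mul_le_of_le_one_right ha (hx₃ i)) (mul_le_of_le_one_right hb (hy₃ i))

/-- The barycentric coordinates are the gaps between consecutive ratios, with 0 put in front and 1
at the end. -/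
theorem simplex_eq_convexHull (hs : ∀ i, 0 < s i) :
    simplex s = convexHull ℝ (Set.range (vertex s)) := by
  refine subset_antisymm (fun x hx => ?_) (convexHull_min ?_ (convex_simplex s))
  · obtain ⟨hx₁, hx₂, hx₃⟩ := hx
    let y : ℕ → ℝ := fun k => k.casesOn 0 fun i => if h : i < n then x ⟨i, h⟩ / s ⟨i, h⟩ else 1
    have hy (i : ℕ) : y (i + 1) = if h : i < n then x ⟨i, h⟩ / s ⟨i, h⟩ else 1 := rfl
    have hmono (i : Fin (n + 1)) : 0 ≤ y (i + 1) - y i := by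
      obtain ⟨i, hi⟩ := i
      rw [sub_nonneg]
      dsimp only
      cases i with
      | zero =>
        rw [hy]
        split_ifs with h
        · exact hx₁ _
        · exact zero_le_one
      | succ i =>
        rw [hy, hy, dif_pos (show i < n by omega)]
        split_ifs with h
        · exact hx₂ _ _ (Fin.mk_le_mk.2 (Nat.le_succ i))
        · exact hx₃ _
    have hsum := sum_ite_le_of_eq_sub (n := n) (y := y) rfl fun _ => rfl
    have hone : ∑ j : Fin (n + 1), (y (j + 1) - y j) = 1 := by
      have := hsum n le_rfl
      rw [hy, dif_neg (lt_irrefl n)] at this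
      rw [← this]
      exact Finset.sum_congr rfl fun j _ => (if_pos (Nat.lt_succ_iff.1 j.isLt)).symm
    have hxy : x = ∑ j : Fin (n + 1), (y (j + 1) - y j) • vertex s j := by
      funext i
      have := hsum i i.isLt.le
      rw [hy, dif_pos i.isLt] at this
      have hsi : (s i : ℝ) ≠ 0 := by exact_mod_cast (hs i).ne'
      rw [eq_div_iff hsi, Finset.sum_mul] at this
      rw [← this, Finset.sum_apply]
      refine Finset.sum_congr rfl fun j _ => ?_
      simp [vertex]
    rw [hxy]
    exact (convex_convexHull ℝ _).sum_mem (fun j _ => hmono j) hone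
      fun j _ => subset_convexHull ℝ _ (Set.mem_range_self j)
  · rintro _ ⟨j, rfl⟩
    exact vertex_mem_simplex hs j

theorem extremePoints_simplex (hs : ∀ i, 0 < s i) :
    (simplex s).extremePoints ℝ = Set.range (vertex s) := by
  refine subset_antisymm ?_ ?_
  · rw [simplex_eq_convexHull hs]
    exact extremePoints_convexHull_subset
  · rintro _ ⟨j, rfl⟩
    -- Each vertex is a corner of this box, hence extreme in the box and so in the smaller simplex.
    have hsub : simplex s ⊆ Set.univ.pi fun i => Set.Icc (0 : ℝ) (s i) := by
      rintro x ⟨hx₁, -, hx₃⟩ i -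
      have hsi : (0 : ℝ) < s i := by exact_mod_cast hs i
      have h₁ := (le_div_iff₀ hsi).1 (hx₁ i)
      have h₃ := (div_le_iff₀ hsi).1 (hx₃ i)
      exact ⟨by linarith, by linarith⟩
    refine inter_extremePoints_subset_extremePoints_of_subset hsub ⟨vertex_mem_simplex hs j, ?_⟩
    rw [extremePoints_pi]
    intro i _
    dsimp only
    rw [Set.extremePoints_Icc (Nat.cast_nonneg _), vertex]
    split_ifs <;> simp

theorem mem_openParallelepiped (hs : ∀ i, 0 < s i) {y : Fin (n + 1) → ℝ} :
    y ∈ openParallelepiped (simplex s) ↔ ∃ c : Fin (n + 1) → ℝ, (∀ j, 0 < c j ∧ c j < 1) ∧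
      y = ∑ j, c j • lift (vertex s j) := by
  have hinj := vertex_injective hs
  have hsum (c : (Fin n → ℝ) → ℝ) :
      ∑ᶠ v ∈ Set.range (vertex s), c v • lift v =
        ∑ j, c (vertex s j) • lift (vertex s j) := by
    rw [finsum_mem_range hinj, finsum_eq_sum_of_fintype]
  simp only [openParallelepiped, extremePoints_simplex hs, Set.forall_mem_range, hsum,
    Set.mem_ofPred_eq]
  constructor
  · rintro ⟨c, hc, hy⟩
    exact ⟨fun j => c (vertex s j), hc, hy⟩
  · rintro ⟨c, hc, hy⟩
    refine ⟨Function.extend (vertex s) c 0, ?_, ?_⟩ <;> simpa only [hinj.extend_apply]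

theorem mem_boxPoints_simplex (hs : ∀ i, 0 < s i) {x : Fin (n + 1) → ℤ} :
    x ∈ boxPoints (simplex s) ↔ ∀ i < n + 1,
      coordinates x i * denominators s (i + 1) < coordinates x (i + 1) * denominators s i ∧
      coordinates x (i + 1) * denominators s i <
        (coordinates x i + denominators s i) * denominators s (i + 1) := by
  have hpos (i : ℕ) : (0 : ℝ) < denominators s i := by exact_mod_cast denominators_pos hs i
  let y (k : ℕ) : ℝ := coordinates x k / denominators s k
  have hy0 : y 0 = 0 := by simp [y, coordinates]
  have hcoord (c : Fin (n + 1) → ℝ) (i : Fin (n + 1)) :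
      (∑ j, c j • lift (vertex s j)) i =
        (∑ j : Fin (n + 1), if (j : ℕ) ≤ i then c j else 0) * denominators s (i + 1) := by
    simp [Finset.sum_apply, lift_vertex, Finset.sum_mul]
  have hx (i : Fin (n + 1)) : (x i : ℝ) = y (i + 1) * denominators s (i + 1) := by
    simp only [y]
    rw [div_mul_cancel₀ _ (hpos _).ne']
    rw [coordinates, dif_pos i.isLt]
  have hcond (i : ℕ) : (0 < y (i + 1) - y i ∧ y (i + 1) - y i < 1) ↔
      coordinates x i * denominators s (i + 1) < coordinates x (i + 1) * denominators s i ∧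
      coordinates x (i + 1) * denominators s i <
        (coordinates x i + denominators s i) * denominators s (i + 1) := by
    refine and_congr ?_ ?_
    · rw [sub_pos, div_lt_div_iff₀ (hpos _) (hpos _)]
      exact_mod_cast Iff.rfl
    · have : 1 + y i = (coordinates x i + denominators s i) / denominators s i := by
        simp only [y]
        field_simp [(hpos i).ne']
        ring
      rw [sub_lt_iff_lt_add, this, div_lt_div_iff₀ (hpos _) (hpos _)]
      exact_mod_cast Iff.rfl
  simp only [← hcond]
  rw [boxPoints, Set.mem_ofPred_eq, mem_openParallelepiped hs]
  constructor
  · rintro ⟨c, hc, h⟩ i hi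
    have hsub := eq_sub_of_sum_ite_le (c := c) (y := y) hy0 (fun i hi => ?_) ⟨i, hi⟩
    · rw [← hsub]; exact hc _
    · have := congrFun h ⟨i, by omega⟩
      rw [hx, hcoord] at this
      exact (mul_right_cancel₀ (hpos _).ne' this).symm
  · intro h
    refine ⟨fun i => y (i + 1) - y i, fun i => h i i.isLt, ?_⟩
    funext i
    rw [hcoord, hx, sum_ite_le_of_eq_sub hy0 (fun _ => rfl) i (by omega)]

theorem bijOn_paths_boxPoints (hs : ∀ i, 0 < s i) :
    Set.BijOn (fun (f : ℕ → ℤ) (i : Fin (n + 1)) => f (i + 1) - f 0 * denominators s (i + 1))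
      (paths (denominators s) (n + 1) 0) (boxPoints (simplex s)) := by
  have hS := denominators_pos hs
  refine ⟨fun f hf => ?_, fun f hf g hg h => ?_, fun x hx => ?_⟩
  · rw [Finset.mem_coe, mem_paths hS] at hf
    rw [mem_boxPoints_simplex hs]
    have hcoord : ∀ k ≤ n + 1, coordinates
        (fun i : Fin (n + 1) => f (i + 1) - f 0 * denominators s (i + 1)) k =
          f k - f 0 * denominators s k
      | 0, _ => by simp [coordinates, denominators]
      | k + 1, hk => by rw [coordinates, dif_pos (by omega)]
    intro i hi
    rw [hcoord i (by omega), hcoord (i + 1) (by omega)]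
    obtain ⟨h₁, h₂⟩ := hf.2 i hi
    exact ⟨by linarith, by linarith⟩
  · rw [Finset.mem_coe, mem_paths hS] at hf hg
    -- The last coordinate of the image is `-f 0`, because the path ends at 0 and the last
    -- denominator is 1.
    have h0 : f 0 = g 0 := by
      simpa [denominators_last, hf.1, hg.1] using congrFun h (Fin.last n)
    funext i
    rcases i with _ | i
    · exact h0
    · by_cases hi : i < n + 1
      · simpa [h0] using congrFun h ⟨i, hi⟩
      · rw [hf.1 _ (by omega), hg.1 _ (by omega)]
  · rw [mem_boxPoints_simplex hs] at hx
    let f (k : ℕ) : ℤ := if k ≤ n + 1 then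
      coordinates x k - coordinates x (n + 1) * denominators s k else 0
    have hf (k : ℕ) (hk : k ≤ n + 1) :
        f k = coordinates x k - coordinates x (n + 1) * denominators s k := if_pos hk
    refine ⟨f, ?_, ?_⟩
    · rw [Finset.mem_coe, mem_paths hS]
      refine ⟨fun i hi => ?_, fun i hi => ?_⟩
      · rcases eq_or_lt_of_le hi with rfl | hlt
        · simp [hf, denominators_last]
        · exact if_neg (by omega)
      · obtain ⟨h₁, h₂⟩ := hx i hi
        rw [hf i (by omega), hf (i + 1) (by omega)]
        exact ⟨by linarith, by linarith⟩
    · funext i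
      dsimp only
      rw [hf _ (by omega), hf 0 (by omega)]
      simp [coordinates, denominators, i.isLt, -Order.lt_add_one_iff]

end Geometry

/-! ### Real-rootedness of the derangement polynomial -/

variable {n : ℕ} {s : Fin n → ℕ}

theorem derangementPolynomial_eq_sum (hs : ∀ i, 0 < s i) :
    derangementPolynomial s =
      ∑ f ∈ paths (denominators s) (n + 1) 0, (X : ℝ[X]) ^ (-f 0).toNat := by
  rw [derangementPolynomial, localHStar, ← finsum_mem_coe_finset]
  refine (finsum_mem_eq_of_bijOn _ (bijOn_paths_boxPoints hs) fun f hf => ?_).symm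
  rw [Finset.mem_coe, mem_paths (denominators_pos hs)] at hf
  simp [denominators_last, hf.1]

theorem derangementPolynomial_coeff_nonneg (hs : ∀ i, 0 < s i) (k : ℕ) :
    0 ≤ (derangementPolynomial s).coeff k := by
  rw [derangementPolynomial_eq_sum hs, finsetSum_coeff]
  refine Finset.sum_nonneg fun f _ => ?_
  rw [coeff_X_pow]
  split_ifs <;> simp

theorem derangementPolynomial_eq_zero_of_aeval_eq_zero (hs : ∀ i, 0 < s i) {z : ℂ}
    (hz : z.im < 0) (h : aeval z (derangementPolynomial s) = 0) :
    derangementPolynomial s = 0 := by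
  have hz0 : z ≠ 0 := by rintro rfl; simp at hz
  have hw : 0 < z⁻¹.im := by
    rw [Complex.inv_im]
    exact div_pos (by linarith) (Complex.normSq_pos.2 hz0)
  have hS := denominators_pos hs
  rw [derangementPolynomial_eq_sum hs, map_sum] at h
  have hsum : ∑ f ∈ paths (denominators s) (n + 1) 0, z⁻¹ ^ f 0 = 0 := by
    rw [← h]
    refine Finset.sum_congr rfl fun f hf => ?_
    have := nonpos_of_mem_paths hS hf
    rw [map_pow, aeval_X, ← zpow_natCast, Int.toNat_of_nonneg (by omega), inv_zpow, zpow_neg]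
  rw [derangementPolynomial_eq_sum hs, paths_eq_empty_of_sum_eq_zero hS rfl hw hsum,
    Finset.sum_empty]

theorem realRooted_derangementPolynomial (hs : ∀ i, 0 < s i) :
    RealRooted (derangementPolynomial s) := by
  by_contra hne
  simp only [RealRooted, not_or, not_forall] at hne
  obtain ⟨h0, z, hz, him⟩ := hne
  rcases lt_or_gt_of_ne him with hlt | hgt
  · exact h0 (derangementPolynomial_eq_zero_of_aeval_eq_zero hs hlt hz)
  · refine h0 (derangementPolynomial_eq_zero_of_aeval_eq_zero hs (z := conj z) (by simpa) ?_)
    rw [aeval_conj, hz, map_zero]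

end LectureHall

theorem mainTheorem1 (n : ℕ) (s : Fin n → ℕ) (hs : ∀ i, 0 < s i) :
    LectureHall.RealRooted (LectureHall.derangementPolynomial s) ∧
    LectureHall.LogConcave (LectureHall.derangementPolynomial s) ∧
    LectureHall.Unimodal (LectureHall.derangementPolynomial s) := by
  have hr := LectureHall.realRooted_derangementPolynomial hs
  have hp := LectureHall.isPF2_of_realRooted
    (LectureHall.derangementPolynomial_coeff_nonneg hs) hr
  exact ⟨hr, hp.logConcave, hp.unimodal⟩
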